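/- **Theorem 5 (distance and angle between focal surfaces).** Identify the space of oriented lines in $\mathbb{R}^3$ with $\mathbb{L}=\{(U,V)\in\mathbb{R}^3\times\mathbb{R}^3 : |U|=1,\ U\cdot V=0\}$, where $U$ is the direction of the line and $V$ its point closest to the origin, and let $\Phi((U,V),r)=V+rU$. Let $\Sigma\subset\mathbb{L}$ be a line congruence, i.e. an immersed $C^1$ surface, locally parametrized by $\mu\mapsto\gamma(\mu)=(U(\mu),V(\mu))\in\mathbb{L}$ with $\mu$ in an open set $W\subset\mathbb{C}$. Near a point $\Phi(\gamma(\mu),r)$ at which $(\mu,r)\mapsto\Phi(\gamma(\mu),r)$ is a local diffeomorphism, let $e_0$ be the unit vector field tangent to the lines, $e_0(\Phi(\gamma(\mu),r))=U(\mu)$; let $(e_0,e_1,e_2)$ be a positively oriented orthonormal frame there and put $e_\pm=\frac1{\sqrt2}(e_1\mp i e_2)$. The optical scalars of $\Sigma$ at that point are $$\rho=\langle\nabla_{e_-}e_+,e_0\rangle=-\langle\nabla_{e_-}e_0,e_+\rangle,\qquad \sigma=\langle\nabla_{e_+}e_+,e_0\rangle=-\langle\nabla_{e_+}e_0,e_+\rangle,$$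 with $\nabla$ the flat connection of $\mathbb{R}^3$ and $\langle\cdot,\cdot\rangle$ the complex bilinear extension of the Euclidean inner product. A point of a line $\gamma(\mu)$ is a *focal point* if $|\rho|$ and $|\sigma|$ tend to $\infty$ as the point is approached along the line. Suppose that on each line $\gamma(\mu)$, $\mu\in W$, there are exactly two focal points, $\Phi(\gamma(\mu),r_1(\mu))$ and $\Phi(\gamma(\mu),r_2(\mu))$ with $r_1(\mu)\neq r_2(\mu)$, that $r=0$ is not a focal point, and that the focal points form two continuously differentiable (regular parametrized) surfaces, i.e. $S_i:\mu\mapsto\Phi(\gamma(\mu),r_i(\mu))$, $i=1,2$, are $C^1$ immersions of $W$ into $\mathbb{R}^3$. For $\mu\in W$ let $\rho_0$ and $\sigma_0$ be the values of $\rho$ and $\sigma$ on $\gamma(\mu)$ at $r=0$, let $\lambda_0=\operatorname{Im}\rho_0$, let $L$ be the distance between the two focal points on $\gamma(\mu)$, and let $\varphi$ be the angle between the normals to $S_1$ and $S_2$ at these two points. Then $|\sigma_0|^2-\lambda_0^2>0$, $\rho_0\bar\rho_0-\sigma_0\bar\sigma_0\neq0$, and $$L=\frac{2\left(|\sigma_0|^2-\lambda_0^2\right)^{1/2}}{\left|\rho_0\bar\rho_0-\sigma_0\bar\sigma_0\right|},\qquad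 \cos^2\varphi=\frac{\lambda_0^2}{|\sigma_0|^2}.$$ -/

import Mathlib

open Filter Topology

namespace LineGeometry

/-- Euclidean three-space. -/
abbrev E3 : Type := EuclideanSpace ℝ (Fin 3)

/-- The space `𝕃` of oriented lines: pairs `(U, V)` with `U` the unit direction and `V` the point
of the line closest to the origin. -/
def orientedLines : Set (E3 × E3) :=
  {l | ‖l.1‖ = 1 ∧ inner ℝ l.1 l.2 = 0}

/-- The point on the line `l = (U, V)` at signed distance `r` from the point closest to the
origin. -/
noncomputable def pointOn (l : E3 × E3) (r : ℝ) : E3 := l.2 + r • l.1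

/-- A `C¹` map from a parameter domain in `ℂ = ℝ²` that is an immersion on `W`. -/
def IsC1ImmersionOn {F : Type*} [NormedAddCommGroup F] [NormedSpace ℝ F]
    (X : ℂ → F) (W : Set ℂ) : Prop :=
  ContDiffOn ℝ 1 X W ∧ ∀ μ ∈ W, Function.Injective (fderiv ℝ X μ)

/-- A (locally parametrized) line congruence: an immersed `C¹` surface in the space of oriented
lines, parametrized by the open set `W`. -/
structure IsLineCongruence (γ : ℂ → E3 × E3) (W : Set ℂ) : Prop where
  isOpen : IsOpen W
  mapsTo : Set.MapsTo γ W orientedLines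
  immersion : IsC1ImmersionOn γ W

/-- The map `(μ, r) ↦ Φ(γ(μ), r)` that sweeps out space by the lines of the congruence. -/
noncomputable def sweep (γ : ℂ → E3 × E3) (q : ℂ × ℝ) : E3 := pointOn (γ q.1) q.2

/-- The covariant derivative `v ↦ ∇_v e₀` at the point `Φ(γ(μ), r)` of the unit vector field `e₀`
tangent to the lines. Where `sweep γ` is a local diffeomorphism, `e₀` is the field determined near
that point by `e₀ (sweep γ (μ', r')) = U(μ')`, so its derivative is `d(U) ∘ (d(sweep γ))⁻¹`. -/
noncomputable def nablaE0 (γ : ℂ → E3 × E3) (μ : ℂ) (r : ℝ) : E3 →L[ℝ] E3 :=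
  (fderiv ℝ (fun q : ℂ × ℝ => (γ q.1).1) (μ, r)).comp
    (fderiv ℝ (sweep γ) (μ, r)).inverse

/-- A real vector as an element of `ℂ ⊗ ℝ³`. -/
noncomputable def toComplex (v : E3) : Fin 3 → ℂ := fun i => (v i : ℂ)

/-- The complex linear extension of a real linear map to `ℂ ⊗ ℝ³`. -/
noncomputable def complexify (T : E3 →L[ℝ] E3) (v : Fin 3 → ℂ) : Fin 3 → ℂ :=
  toComplex (T (WithLp.toLp 2 fun i => (v i).re)) +
    Complex.I • toComplex (T (WithLp.toLp 2 fun i => (v i).im))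

/-- `e₊ = (e₁ - i e₂)/√2`. -/
noncomputable def ePlus (e₁ e₂ : E3) : Fin 3 → ℂ :=
  ((Real.sqrt 2 : ℝ) : ℂ)⁻¹ • (toComplex e₁ - Complex.I • toComplex e₂)

/-- `e₋ = (e₁ + i e₂)/√2`. -/
noncomputable def eMinus (e₁ e₂ : E3) : Fin 3 → ℂ :=
  ((Real.sqrt 2 : ℝ) : ℂ)⁻¹ • (toComplex e₁ + Complex.I • toComplex e₂)

/-- `(e₀, e₁, e₂)` is an orthonormal frame with the standard orientation of `ℝ³`. -/
def IsPositiveFrame (e₀ e₁ e₂ : E3) : Prop :=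
  Orthonormal ℝ ![e₀, e₁, e₂] ∧
    0 < (Matrix.of fun i j : Fin 3 => (![e₀, e₁, e₂] i) j).det

/-- `e₁, e₂` complete the direction `e₀` of the lines to a congruence frame over `W`; the frame may
depend on the line and on the point of the line. -/
def IsCongruenceFrame (γ : ℂ → E3 × E3) (W : Set ℂ) (e₁ e₂ : ℂ → ℝ → E3) : Prop :=
  ∀ μ ∈ W, ∀ r : ℝ, IsPositiveFrame (γ μ).1 (e₁ μ r) (e₂ μ r)

/-- The optical scalar `ρ = ⟨∇_{e₋} e₊, e₀⟩ = -⟨∇_{e₋} e₀, e₊⟩` at `Φ(γ(μ), r)`, where `⟨·,·⟩` is the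
complex bilinear extension of the Euclidean inner product. Its real part is the divergence and its
imaginary part the twist; with this sign it solves `∂ρ/∂r = ρ² + |σ|²`. -/
noncomputable def opticalRho (γ : ℂ → E3 × E3) (e₁ e₂ : ℂ → ℝ → E3) (μ : ℂ) (r : ℝ) : ℂ :=
  -(complexify (nablaE0 γ μ r) (eMinus (e₁ μ r) (e₂ μ r)) ⬝ᵥ ePlus (e₁ μ r) (e₂ μ r))

/-- The optical scalar `σ = ⟨∇_{e₊} e₊, e₀⟩ = -⟨∇_{e₊} e₀, e₊⟩` (the shear) at `Φ(γ(μ), r)`. -/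
noncomputable def opticalSigma (γ : ℂ → E3 × E3) (e₁ e₂ : ℂ → ℝ → E3) (μ : ℂ) (r : ℝ) : ℂ :=
  -(complexify (nablaE0 γ μ r) (ePlus (e₁ μ r) (e₂ μ r)) ⬝ᵥ ePlus (e₁ μ r) (e₂ μ r))

/-- `Φ(γ(μ), r)` is a focal point on the line `γ(μ)`: both optical scalars blow up there, as the
point is approached along the line. -/
def IsFocalAt (γ : ℂ → E3 × E3) (e₁ e₂ : ℂ → ℝ → E3) (μ : ℂ) (r : ℝ) : Prop :=
  Tendsto (fun s => ‖opticalRho γ e₁ e₂ μ s‖) (𝓝[≠] r) atTop ∧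
    Tendsto (fun s => ‖opticalSigma γ e₁ e₂ μ s‖) (𝓝[≠] r) atTop

/-- `n` is a normal vector at the parameter `μ` of the parametrized surface `X`. -/
def IsNormalAt (X : ℂ → E3) (μ : ℂ) (n : E3) : Prop :=
  n ≠ 0 ∧ ∀ w : ℂ, inner ℝ n (fderiv ℝ X μ w) = 0

end LineGeometry

open LineGeometry

/-! Along one line the derivative of `sweep γ` is `dV w + r • dU w + t • U`. It is invertible
exactly when `planeDet`, a polynomial in `r` of degree at most two, is nonzero. Where it is
invertible, `∇e₀` is continuous and `ρ` stays bounded, so both focal distances are roots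
(`not_isFocalAt_of_isInvertible`). The polynomial is not identically zero, so `0` is not a third
root.

Let `N` be `∇e₀` at `r = 0` restricted to the plane orthogonal to the line. Then `dU = N ∘ dV` in
that plane, so the focal distances satisfy `det (1 + r N) = 0`. Here `|ρ₀|² - |σ₀|² = det N`, and
`|σ₀|² - λ₀²` is a quarter of the discriminant `(tr N)² - 4 det N`; Vieta's formulas give `L`.

A normal to `Sᵢ` is orthogonal to the line and lies in the kernel of `1 + rᵢ Nᵀ`. Two such
eigenvectors fail to be orthogonal only through the antisymmetric part of `N`, which is the twist
`λ₀` (`eigenvectors_dot_sq`). -/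

namespace LineGeometry

/-! ### Coordinates in an orthonormal frame. -/

section Frame

variable {u e₁ e₂ : E3}

theorem orthonormal_inner (h : Orthonormal ℝ ![u, e₁, e₂]) :
    inner ℝ u u = 1 ∧ inner ℝ e₁ e₁ = 1 ∧ inner ℝ e₂ e₂ = 1 ∧ inner ℝ u e₁ = 0 ∧
      inner ℝ u e₂ = 0 ∧ inner ℝ e₁ e₂ = 0 := by
  have h' := orthonormal_iff_ite.1 h
  exact ⟨by simpa using h' 0 0, by simpa using h' 1 1, by simpa using h' 2 2,
    by simpa using h' 0 1, by simpa using h' 0 2, by simpa using h' 1 2⟩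

theorem orthonormal_expand (h : Orthonormal ℝ ![u, e₁, e₂]) (x : E3) :
    x = inner ℝ u x • u + inner ℝ e₁ x • e₁ + inner ℝ e₂ x • e₂ := by
  have hs : ⊤ ≤ Submodule.span ℝ (Set.range ![u, e₁, e₂]) := by
    rw [h.linearIndependent.span_eq_top_of_card_eq_finrank (by simp)]
  have := (OrthonormalBasis.mk h hs).sum_repr' x
  simpa [Fin.sum_univ_three] using this.symm

theorem orthonormal_inner_eq (h : Orthonormal ℝ ![u, e₁, e₂]) (x y : E3) :
    inner ℝ x y = inner ℝ u x * inner ℝ u y + inner ℝ e₁ x * inner ℝ e₁ y +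
      inner ℝ e₂ x * inner ℝ e₂ y := by
  conv_lhs => rw [orthonormal_expand h x]
  simp only [inner_add_left, real_inner_smul_left]

end Frame

/-! ### Optical scalars as real matrix entries of `∇e₀`. -/

section OpticalScalars

theorem toComplex_dotProduct (x y : E3) :
    toComplex x ⬝ᵥ toComplex y = ((inner ℝ x y : ℝ) : ℂ) := by
  simp only [dotProduct, toComplex, Fin.sum_univ_three, PiLp.inner_apply, RCLike.inner_apply,
    conj_trivial]
  push_cast
  ring

theorem complexify_add_smul (T : E3 →L[ℝ] E3) (c d : ℝ) (x y : E3) :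
    complexify T ((c : ℂ) • (toComplex x + ((d : ℂ) * Complex.I) • toComplex y)) =
      (c : ℂ) • (toComplex (T x) + ((d : ℂ) * Complex.I) • toComplex (T y)) := by
  have h1 : (WithLp.toLp 2 fun i => (((c : ℂ) • (toComplex x +
      ((d : ℂ) * Complex.I) • toComplex y)) i).re : E3) = c • x := by
    ext i; simp [toComplex]
  have h2 : (WithLp.toLp 2 fun i => (((c : ℂ) • (toComplex x +
      ((d : ℂ) * Complex.I) • toComplex y)) i).im : E3) = (c * d) • y := by
    ext i; simp [toComplex]; ring
  rw [complexify, h1, h2, map_smul, map_smul]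
  ext i
  simp [toComplex]
  ring

theorem ePlus_eq (e₁ e₂ : E3) : ePlus e₁ e₂ =
    (((Real.sqrt 2)⁻¹ : ℝ) : ℂ) • (toComplex e₁ + (((-1 : ℝ) : ℂ) * Complex.I) • toComplex e₂) := by
  ext i; simp [ePlus, sub_eq_add_neg]

theorem eMinus_eq (e₁ e₂ : E3) : eMinus e₁ e₂ =
    (((Real.sqrt 2)⁻¹ : ℝ) : ℂ) • (toComplex e₁ + (((1 : ℝ) : ℂ) * Complex.I) • toComplex e₂) := by
  ext i; simp [eMinus]

/-- The signs `d, d' = ±1` select `e₊` or `e₋`, so one computation serves both `ρ` and `σ`. -/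
theorem complexify_dotProduct (T : E3 →L[ℝ] E3) (d d' : ℝ) (x y : E3) :
    complexify T ((((Real.sqrt 2)⁻¹ : ℝ) : ℂ) •
        (toComplex x + ((d : ℂ) * Complex.I) • toComplex y)) ⬝ᵥ
      ((((Real.sqrt 2)⁻¹ : ℝ) : ℂ) • (toComplex x + ((d' : ℂ) * Complex.I) • toComplex y)) =
    ((((inner ℝ x (T x) - d * d' * inner ℝ y (T y)) / 2 : ℝ) : ℂ) +
      (((d * inner ℝ x (T y) + d' * inner ℝ y (T x)) / 2 : ℝ) : ℂ) * Complex.I) := by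
  have hs : (((Real.sqrt 2)⁻¹ : ℝ) : ℂ) * (((Real.sqrt 2)⁻¹ : ℝ) : ℂ) = 1 / 2 := by
    rw [← Complex.ofReal_mul, ← mul_inv, Real.mul_self_sqrt (by norm_num)]
    norm_num
  rw [complexify_add_smul]
  generalize (((Real.sqrt 2)⁻¹ : ℝ) : ℂ) = c at hs ⊢
  simp only [smul_dotProduct, dotProduct_smul, add_dotProduct, dotProduct_add,
    toComplex_dotProduct, smul_eq_mul]
  rw [real_inner_comm x, real_inner_comm x, real_inner_comm y, real_inner_comm y]
  push_cast
  linear_combination ((inner ℝ x (T x) : ℂ) + d * Complex.I * inner ℝ x (T y) +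
    d' * Complex.I * (inner ℝ y (T x) + d * Complex.I * inner ℝ y (T y))) * hs +
    (d * d' * inner ℝ y (T y) / 2 : ℂ) * Complex.I_sq

variable (γ : ℂ → E3 × E3) (e₁ e₂ : ℂ → ℝ → E3) (μ : ℂ) (r : ℝ)

theorem opticalRho_eq : opticalRho γ e₁ e₂ μ r =
    -((((inner ℝ (e₁ μ r) (nablaE0 γ μ r (e₁ μ r)) +
        inner ℝ (e₂ μ r) (nablaE0 γ μ r (e₂ μ r))) / 2 : ℝ) : ℂ) +
      (((inner ℝ (e₁ μ r) (nablaE0 γ μ r (e₂ μ r)) -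
        inner ℝ (e₂ μ r) (nablaE0 γ μ r (e₁ μ r))) / 2 : ℝ) : ℂ) * Complex.I) := by
  rw [opticalRho, eMinus_eq, ePlus_eq, complexify_dotProduct]
  congr 4 <;> ring_nf

theorem opticalSigma_eq : opticalSigma γ e₁ e₂ μ r =
    -((((inner ℝ (e₁ μ r) (nablaE0 γ μ r (e₁ μ r)) -
        inner ℝ (e₂ μ r) (nablaE0 γ μ r (e₂ μ r))) / 2 : ℝ) : ℂ) +
      (((-inner ℝ (e₁ μ r) (nablaE0 γ μ r (e₂ μ r)) -
        inner ℝ (e₂ μ r) (nablaE0 γ μ r (e₁ μ r))) / 2 : ℝ) : ℂ) * Complex.I) := by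
  rw [opticalSigma, ePlus_eq, complexify_dotProduct]
  congr 4 <;> ring_nf

theorem norm_sq_neg_add_mul_I (x y : ℝ) : ‖-((x : ℂ) + (y : ℂ) * Complex.I)‖ ^ 2 =
    x ^ 2 + y ^ 2 := by
  rw [norm_neg, Complex.sq_norm, Complex.normSq_add_mul_I]

variable {γ e₁ e₂ μ r}

theorem norm_opticalRho_le (h₁ : ‖e₁ μ r‖ = 1) (h₂ : ‖e₂ μ r‖ = 1) :
    ‖opticalRho γ e₁ e₂ μ r‖ ≤ 2 * ‖nablaE0 γ μ r‖ := by
  have key : ∀ x y : E3, ‖x‖ = 1 → ‖y‖ = 1 →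
      |inner ℝ x (nablaE0 γ μ r y)| ≤ ‖nablaE0 γ μ r‖ := fun x y hx hy => by
    refine (abs_real_inner_le_norm _ _).trans ?_
    rw [hx, one_mul]
    exact (nablaE0 γ μ r).unit_le_opNorm y hy.le
  rw [opticalRho_eq, norm_neg]
  refine (norm_add_le _ _).trans ?_
  rw [norm_mul, Complex.norm_I, mul_one, Complex.norm_real, Complex.norm_real, Real.norm_eq_abs,
    Real.norm_eq_abs, abs_div, abs_div, abs_two]
  have a1 := abs_add_le (inner ℝ (e₁ μ r) (nablaE0 γ μ r (e₁ μ r)))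
    (inner ℝ (e₂ μ r) (nablaE0 γ μ r (e₂ μ r)))
  have a2 := abs_sub (inner ℝ (e₁ μ r) (nablaE0 γ μ r (e₂ μ r)))
    (inner ℝ (e₂ μ r) (nablaE0 γ μ r (e₁ μ r)))
  linarith [key _ _ h₁ h₁, key _ _ h₂ h₂, key _ _ h₁ h₂, key _ _ h₂ h₁]

end OpticalScalars

/-! ### Derivatives of the sweep map and of the focal surfaces. -/

section Derivatives

variable {γ : ℂ → E3 × E3} {W : Set ℂ} {μ : ℂ}

theorem IsC1ImmersionOn.differentiableAt {F : Type*} [NormedAddCommGroup F] [NormedSpace ℝ F]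
    {X : ℂ → F} (h : IsC1ImmersionOn X W) (hW : IsOpen W) (hμ : μ ∈ W) :
    DifferentiableAt ℝ X μ :=
  (h.1.differentiableOn one_ne_zero).differentiableAt (hW.mem_nhds hμ)

theorem fderiv_direction (hd : DifferentiableAt ℝ γ μ) (r : ℝ) :
    fderiv ℝ (fun q : ℂ × ℝ => (γ q.1).1) (μ, r) =
      (fderiv ℝ (fun w => (γ w).1) μ).comp (ContinuousLinearMap.fst ℝ ℂ ℝ) := by
  have h : HasFDerivAt (fun w => (γ w).1) (fderiv ℝ (fun w => (γ w).1) μ)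
      (Prod.fst (μ, r)) := hd.fst.hasFDerivAt
  exact (h.comp (μ, r) hasFDerivAt_fst).fderiv

theorem fderiv_sweep_apply (hd : DifferentiableAt ℝ γ μ) (r : ℝ) (w : ℂ) (t : ℝ) :
    fderiv ℝ (sweep γ) (μ, r) (w, t) =
      fderiv ℝ (fun w => (γ w).2) μ w + r • fderiv ℝ (fun w => (γ w).1) μ w + t • (γ μ).1 := by
  have h₁ : HasFDerivAt (fun w => (γ w).1) (fderiv ℝ (fun w => (γ w).1) μ)
      (Prod.fst (μ, r)) := hd.fst.hasFDerivAt
  have h₂ : HasFDerivAt (fun w => (γ w).2) (fderiv ℝ (fun w => (γ w).2) μ)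
      (Prod.fst (μ, r)) := hd.snd.hasFDerivAt
  have h := (h₂.comp (μ, r) hasFDerivAt_fst).add
    ((hasFDerivAt_snd (𝕜 := ℝ) (p := (μ, r))).smul (h₁.comp (μ, r) hasFDerivAt_fst))
  have h' : HasFDerivAt (sweep γ) _ (μ, r) := h
  rw [h'.fderiv]
  simp [add_assoc]

/-- No regularity of `r` is assumed: since `U ⊥ V`, it is recovered on `W` as `⟨U, S⟩`, which is
differentiable. Its derivative only contributes along the line. -/
theorem fderiv_pointOn_apply (hγ : IsLineCongruence γ W) (hμ : μ ∈ W) {r : ℂ → ℝ} {S : ℂ → E3}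
    (hS : ∀ μ ∈ W, S μ = pointOn (γ μ) (r μ)) (hC : IsC1ImmersionOn S W) (w : ℂ) :
    ∃ c : ℝ, fderiv ℝ S μ w = fderiv ℝ (fun w => (γ w).2) μ w +
      r μ • fderiv ℝ (fun w => (γ w).1) μ w + c • (γ μ).1 := by
  have hd := hγ.immersion.differentiableAt hγ.isOpen hμ
  have hSd := hC.differentiableAt hγ.isOpen hμ
  have hr : ∀ z ∈ W, inner ℝ (γ z).1 (S z) = r z := fun z hz => by
    rw [hS z hz, pointOn, inner_add_right, (hγ.mapsTo hz).2, real_inner_smul_right,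
      real_inner_self_eq_norm_sq, (hγ.mapsTo hz).1]
    ring
  have hg : DifferentiableAt ℝ (fun z => inner ℝ (γ z).1 (S z)) μ := hd.fst.inner ℝ hSd
  have h := hd.snd.hasFDerivAt.add (hg.hasFDerivAt.smul hd.fst.hasFDerivAt)
  have he : S =ᶠ[𝓝 μ] fun z => (γ z).2 + (inner ℝ (γ z).1 (S z) : ℝ) • (γ z).1 := by
    filter_upwards [hγ.isOpen.mem_nhds hμ] with z hz
    rw [hr z hz, hS z hz, pointOn]
  have h' : HasFDerivAt S _ μ := h.congr_of_eventuallyEq he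
  refine ⟨fderiv ℝ (fun z => (inner ℝ (γ z).1 (S z) : ℝ)) μ w, ?_⟩
  rw [h'.fderiv, add_assoc, ← hr μ hμ]
  rfl

end Derivatives

/-! ### Focal points and degeneracy of the sweep map. -/

section Jacobian

/-- The determinant of `w ↦ b w + r • a w`, read in the plane spanned by `e₁` and `e₂`. -/
noncomputable def planeDet (a b : ℂ →L[ℝ] E3) (e₁ e₂ : E3) (r : ℝ) : ℝ :=
  inner ℝ e₁ (b 1 + r • a 1) * inner ℝ e₂ (b Complex.I + r • a Complex.I) -
    inner ℝ e₁ (b Complex.I + r • a Complex.I) * inner ℝ e₂ (b 1 + r • a 1)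

theorem map_complex_eq (a : ℂ →L[ℝ] E3) (w : ℂ) : a w = w.re • a 1 + w.im • a Complex.I := by
  rw [← map_smul, ← map_smul, ← map_add]
  congr 1
  apply Complex.ext <;> simp

theorem planeDet_eq_zero_iff (a b : ℂ →L[ℝ] E3) (e₁ e₂ : E3) (r : ℝ) :
    planeDet a b e₁ e₂ r = 0 ↔
      ∃ w : ℂ, w ≠ 0 ∧ inner ℝ e₁ (b w + r • a w) = 0 ∧ inner ℝ e₂ (b w + r • a w) = 0 := by
  have hlin : ∀ (e : E3) (w : ℂ), inner ℝ e (b w + r • a w) =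
      w.re * inner ℝ e (b 1 + r • a 1) + w.im * inner ℝ e (b Complex.I + r • a Complex.I) := by
    intro e w
    rw [map_complex_eq a w, map_complex_eq b w]
    simp only [inner_add_right, real_inner_smul_right]
    ring
  have h₁ := hlin e₁
  have h₂ := hlin e₂
  clear hlin
  rw [planeDet]
  generalize inner ℝ e₁ (b 1 + r • a 1) = p at h₁ h₂ ⊢
  generalize inner ℝ e₁ (b Complex.I + r • a Complex.I) = q at h₁ h₂ ⊢
  generalize inner ℝ e₂ (b 1 + r • a 1) = s at h₁ h₂ ⊢
  generalize inner ℝ e₂ (b Complex.I + r • a Complex.I) = t at h₁ h₂ ⊢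
  simp only [h₁, h₂]
  constructor
  · intro h
    -- A nonzero row, rotated by a right angle, spans the kernel; the vanishing determinant takes
    -- care of the other row.
    by_cases hpq : p = 0 ∧ q = 0
    · by_cases hst : s = 0 ∧ t = 0
      · exact ⟨1, one_ne_zero, by simp [hpq], by simp [hst]⟩
      · refine ⟨⟨t, -s⟩, fun h0 => hst ?_, by simp [hpq], by simp; ring⟩
        exact ⟨by simpa using congrArg Complex.im h0, by simpa using congrArg Complex.re h0⟩
    · refine ⟨⟨q, -p⟩, fun h0 => hpq ?_, by simp; ring, by simp; linarith⟩
      exact ⟨by simpa using congrArg Complex.im h0, by simpa using congrArg Complex.re h0⟩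
  · rintro ⟨w, hw, h1, h2⟩
    by_contra hne
    apply hw
    apply Complex.ext
    · apply mul_left_cancel₀ hne; rw [Complex.zero_re, mul_zero]; linear_combination t * h1 - q * h2
    · apply mul_left_cancel₀ hne; rw [Complex.zero_im, mul_zero]; linear_combination p * h2 - s * h1

variable {γ : ℂ → E3 × E3} {W : Set ℂ} {μ : ℂ} {e₁ e₂ : E3}

theorem fderiv_sweep_isInvertible_iff (hγ : IsLineCongruence γ W) (hμ : μ ∈ W)
    (he : Orthonormal ℝ ![(γ μ).1, e₁, e₂]) (r : ℝ) :
    (fderiv ℝ (sweep γ) (μ, r)).IsInvertible ↔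
      planeDet (fderiv ℝ (fun w => (γ w).1) μ) (fderiv ℝ (fun w => (γ w).2) μ) e₁ e₂ r ≠ 0 := by
  have hd := hγ.immersion.differentiableAt hγ.isOpen hμ
  obtain ⟨huu, -, -, hu1, hu2, -⟩ := orthonormal_inner he
  rw [real_inner_comm] at hu1 hu2
  rw [Ne, planeDet_eq_zero_iff]
  constructor
  · rintro ⟨T, hT⟩ ⟨w, hw, h1, h2⟩
    have hD := fderiv_sweep_apply hd r w
    set v := fderiv ℝ (fun w => (γ w).2) μ w + r • fderiv ℝ (fun w => (γ w).1) μ w with hv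
    have hx := orthonormal_expand he v
    rw [h1, h2, zero_smul, zero_smul, add_zero, add_zero] at hx
    have h0 : fderiv ℝ (sweep γ) (μ, r) (w, -inner ℝ (γ μ).1 v) = 0 := by
      rw [hD, neg_smul, ← hx, add_neg_cancel]
    rw [← hT] at h0
    have := T.injective (h0.trans (map_zero T).symm)
    exact hw (congrArg Prod.fst this)
  · intro hno
    have hinj : Function.Injective (fderiv ℝ (sweep γ) (μ, r) : ℂ × ℝ →ₗ[ℝ] E3) := by
      rw [injective_iff_map_eq_zero]
      rintro ⟨w, t⟩ h0
      have h0' : fderiv ℝ (sweep γ) (μ, r) (w, t) = 0 := h0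
      rw [fderiv_sweep_apply hd] at h0'
      have hw : w = 0 := by
        by_contra hw
        refine hno ⟨w, hw, ?_, ?_⟩
        · simpa only [inner_add_right _ _ (t • (γ μ).1), real_inner_smul_right, hu1, mul_zero,
            add_zero, inner_zero_right] using congrArg (inner ℝ e₁) h0'
        · simpa only [inner_add_right _ _ (t • (γ μ).1), real_inner_smul_right, hu2, mul_zero,
            add_zero, inner_zero_right] using congrArg (inner ℝ e₂) h0'
      subst hw
      have ht := congrArg (inner ℝ (γ μ).1) h0'
      simp only [map_zero, smul_zero, zero_add, real_inner_smul_right, huu, mul_one,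
        inner_zero_right] at ht
      rw [ht]; rfl
    have hfin : Module.finrank ℝ (ℂ × ℝ) = Module.finrank ℝ E3 := by
      simp [Complex.finrank_real_complex]
    refine ⟨(LinearEquiv.ofInjectiveOfFinrankEq _ hinj hfin).toContinuousLinearEquiv, ?_⟩
    exact ContinuousLinearMap.ext fun x => rfl

/-- Inversion is continuous at invertible operators, so `∇e₀` has a finite limit along the line and
bounds `ρ`. -/
theorem not_isFocalAt_of_isInvertible (hγ : IsLineCongruence γ W) (hμ : μ ∈ W)
    {f₁ f₂ : ℂ → ℝ → E3} (hf : IsCongruenceFrame γ W f₁ f₂) {r : ℝ}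
    (h : (fderiv ℝ (sweep γ) (μ, r)).IsInvertible) : ¬ IsFocalAt γ f₁ f₂ μ r := by
  intro hfoc
  have hd := hγ.immersion.differentiableAt hγ.isOpen hμ
  have hD : Continuous fun s : ℝ => fderiv ℝ (sweep γ) (μ, s) := by
    refine continuous_clm_apply.2 fun x => ?_
    obtain ⟨w, t⟩ := x
    simp only [fderiv_sweep_apply hd]
    fun_prop
  have hinv : ContinuousAt (ContinuousLinearMap.inverse : (ℂ × ℝ →L[ℝ] E3) → _)
      (fderiv ℝ (sweep γ) (μ, r)) := by
    obtain ⟨T, hT⟩ := h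
    rw [← hT]
    exact (contDiffAt_map_inverse (n := 0) T).continuousAt
  have hN : ContinuousAt (fun s : ℝ => nablaE0 γ μ s) r := by
    simp only [nablaE0, fderiv_direction hd]
    exact continuousAt_const.clm_comp (hinv.comp (f := fun s : ℝ => fderiv ℝ (sweep γ) (μ, s))
      hD.continuousAt)
  have hb : Tendsto (fun s : ℝ => 2 * ‖nablaE0 γ μ s‖) (𝓝[≠] r) (𝓝 (2 * ‖nablaE0 γ μ r‖)) :=
    ((hN.norm.const_mul 2).tendsto).mono_left nhdsWithin_le_nhds
  refine not_tendsto_atTop_of_tendsto_nhds hb (tendsto_atTop_mono (fun s => ?_) hfoc.1)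
  exact norm_opticalRho_le ((hf μ hμ s).1.1 1) ((hf μ hμ s).1.1 2)

/-- The inverse of a non-invertible operator is `0` by convention, so a line degenerate everywhere
would have `ρ = 0` throughout and no blow-up. -/
theorem IsFocalAt.exists_isInvertible {f₁ f₂ : ℂ → ℝ → E3} {r : ℝ}
    (h : IsFocalAt γ f₁ f₂ μ r) : ∃ s, (fderiv ℝ (sweep γ) (μ, s)).IsInvertible := by
  by_contra! hno
  have h0 : ∀ s, opticalRho γ f₁ f₂ μ s = 0 := fun s => by
    have : nablaE0 γ μ s = 0 := by
      rw [nablaE0, ContinuousLinearMap.inverse_of_not_isInvertible (hno s)]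
      simp
    simp [opticalRho_eq, this]
  have h1 := h.1
  simp only [h0, norm_zero] at h1
  exact not_tendsto_atTop_of_tendsto_nhds tendsto_const_nhds h1

theorem nablaE0_fderiv_sweep (hd : DifferentiableAt ℝ γ μ) {r : ℝ}
    (h : (fderiv ℝ (sweep γ) (μ, r)).IsInvertible) (w : ℂ) (t : ℝ) :
    nablaE0 γ μ r (fderiv ℝ (sweep γ) (μ, r) (w, t)) = fderiv ℝ (fun w => (γ w).1) μ w := by
  obtain ⟨T, hT⟩ := h
  rw [nablaE0, fderiv_direction hd, ← hT, ContinuousLinearMap.inverse_equiv]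
  simp

end Jacobian

/-! ### Quadratic roots and eigenvectors of a 2×2 matrix. -/

section Algebra

/-- Otherwise `0, r₁, r₂` would be three roots of a nonzero polynomial of degree at most two. -/
theorem quadratic_const_ne_zero {p₀ p₁ p₂ r₁ r₂ s : ℝ} (hne : r₁ ≠ r₂) (h₁ : r₁ ≠ 0) (h₂ : r₂ ≠ 0)
    (hr₁ : p₀ + p₁ * r₁ + p₂ * r₁ ^ 2 = 0) (hr₂ : p₀ + p₁ * r₂ + p₂ * r₂ ^ 2 = 0)
    (hs : p₀ + p₁ * s + p₂ * s ^ 2 ≠ 0) : p₀ ≠ 0 := by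
  rintro rfl
  have e₁ : p₁ + p₂ * r₁ = 0 := mul_left_cancel₀ h₁ (by linear_combination hr₁)
  have e₂ : p₁ + p₂ * r₂ = 0 := mul_left_cancel₀ h₂ (by linear_combination hr₂)
  have e₃ : p₂ = 0 := mul_left_cancel₀ (sub_ne_zero.2 hne) (by linear_combination e₁ - e₂)
  apply hs
  subst e₃
  linear_combination s * e₁

theorem det_mul_roots {t d r₁ r₂ : ℝ} (hne : r₁ ≠ r₂) (h₁ : 1 + r₁ * t + r₁ ^ 2 * d = 0)
    (h₂ : 1 + r₂ * t + r₂ ^ 2 * d = 0) : d * (r₁ * r₂) = 1 ∧ t = -d * (r₁ + r₂) := by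
  have e₁ : t = -d * (r₁ + r₂) :=
    mul_left_cancel₀ (sub_ne_zero.2 hne) (by linear_combination h₁ - h₂)
  refine ⟨?_, e₁⟩
  subst e₁
  linear_combination -h₁

theorem eigenvectors_dot_sq {a b c d r₁ r₂ x₁ x₂ y₁ y₂ : ℝ}
    (hd : (a * d - b * c) * (r₁ * r₂) = 1)
    (hx₁ : x₁ + r₁ * (a * x₁ + c * x₂) = 0) (hx₂ : x₂ + r₁ * (b * x₁ + d * x₂) = 0)
    (hy₁ : y₁ + r₂ * (a * y₁ + c * y₂) = 0) (hy₂ : y₂ + r₂ * (b * y₁ + d * y₂) = 0) :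
    (x₁ * y₁ + x₂ * y₂) ^ 2 * ((a * d - b * c) ^ 2 * (r₁ - r₂) ^ 2 + (b - c) ^ 2) =
      (b - c) ^ 2 * ((x₁ ^ 2 + x₂ ^ 2) * (y₁ ^ 2 + y₂ ^ 2)) := by
  -- Pairing each eigenvector equation with the other vector cancels the symmetric part of the
  -- matrix. Squaring and Lagrange's identity `(x·y)² + (x×y)² = |x|²|y|²` then finish.
  have key : (a * d - b * c) * (r₁ - r₂) * (x₁ * y₁ + x₂ * y₂) =
      (b - c) * (x₁ * y₂ - x₂ * y₁) := by
    have h : (r₁ - r₂) * (x₁ * y₁ + x₂ * y₂) = r₁ * r₂ * ((b - c) * (x₁ * y₂ - x₂ * y₁)) := by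
      linear_combination r₁ * (x₁ * hy₁ + x₂ * hy₂) - r₂ * (y₁ * hx₁ + y₂ * hx₂)
    linear_combination (a * d - b * c) * h + (b - c) * (x₁ * y₂ - x₂ * y₁) * hd
  linear_combination ((a * d - b * c) * (r₁ - r₂) * (x₁ * y₁ + x₂ * y₂) +
      (b - c) * (x₁ * y₂ - x₂ * y₁)) * key

end Algebra

/-! ### Normals of the focal surfaces in terms of `∇e₀` at `r = 0`. -/

section FocalNormals

variable {γ : ℂ → E3 × E3} {W : Set ℂ} {μ : ℂ} {e₁ e₂ : E3}

theorem nablaE0_direction (hγ : IsLineCongruence γ W) (hμ : μ ∈ W) {r : ℝ}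
    (h : (fderiv ℝ (sweep γ) (μ, r)).IsInvertible) : nablaE0 γ μ r (γ μ).1 = 0 := by
  have hd := hγ.immersion.differentiableAt hγ.isOpen hμ
  simpa [fderiv_sweep_apply hd] using nablaE0_fderiv_sweep hd h 0 1

/-- In the plane orthogonal to the line, `dU` is `∇e₀` after `dV`. -/
theorem inner_fderiv_direction (hγ : IsLineCongruence γ W) (hμ : μ ∈ W)
    (he : Orthonormal ℝ ![(γ μ).1, e₁, e₂])
    (h : (fderiv ℝ (sweep γ) (μ, 0)).IsInvertible) (e : E3) (w : ℂ) :
    inner ℝ e (fderiv ℝ (fun w => (γ w).1) μ w) =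
      inner ℝ e (nablaE0 γ μ 0 e₁) * inner ℝ e₁ (fderiv ℝ (fun w => (γ w).2) μ w) +
      inner ℝ e (nablaE0 γ μ 0 e₂) * inner ℝ e₂ (fderiv ℝ (fun w => (γ w).2) μ w) := by
  have hd := hγ.immersion.differentiableAt hγ.isOpen hμ
  have h1 := nablaE0_fderiv_sweep hd h w 0
  rw [fderiv_sweep_apply hd, zero_smul, zero_smul, add_zero, add_zero,
    orthonormal_expand he (fderiv ℝ (fun w => (γ w).2) μ w)] at h1
  simp only [map_add, map_smul, nablaE0_direction hγ hμ h, smul_zero, zero_add] at h1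
  rw [← h1, inner_add_right, real_inner_smul_right, real_inner_smul_right]
  ring

/-- In a degenerate direction `w` the vector `dS w` is a multiple of `U`, nonzero because `S` is an
immersion. So the line is tangent to its focal surface. -/
theorem IsNormalAt.inner_direction (hγ : IsLineCongruence γ W) (hμ : μ ∈ W)
    (he : Orthonormal ℝ ![(γ μ).1, e₁, e₂]) {r : ℂ → ℝ} {S : ℂ → E3}
    (hS : ∀ μ ∈ W, S μ = pointOn (γ μ) (r μ)) (hC : IsC1ImmersionOn S W)
    (h0 : planeDet (fderiv ℝ (fun w => (γ w).1) μ) (fderiv ℝ (fun w => (γ w).2) μ) e₁ e₂ (r μ) = 0)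
    {n : E3} (hn : IsNormalAt S μ n) : inner ℝ (γ μ).1 n = 0 := by
  obtain ⟨w, hw, h1, h2⟩ := (planeDet_eq_zero_iff _ _ _ _ _).1 h0
  obtain ⟨c, hc⟩ := fderiv_pointOn_apply hγ hμ hS hC w
  rw [orthonormal_expand he (fderiv ℝ (fun w => (γ w).2) μ w +
      r μ • fderiv ℝ (fun w => (γ w).1) μ w), h1, h2, zero_smul, zero_smul, add_zero, add_zero,
    ← add_smul] at hc
  have hnw := hn.2 w
  rw [hc, real_inner_smul_right] at hnw
  rcases mul_eq_zero.1 hnw with h | h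
  · rw [h, zero_smul] at hc
    exact absurd (hC.2 μ hμ (hc.trans (map_zero _).symm)) hw
  · rwa [real_inner_comm]

/-- The normal to a focal surface is an eigenvector of the transpose of `∇e₀`. -/
theorem IsNormalAt.eigenvector (hγ : IsLineCongruence γ W) (hμ : μ ∈ W)
    (he : Orthonormal ℝ ![(γ μ).1, e₁, e₂]) {r : ℂ → ℝ} {S : ℂ → E3}
    (hS : ∀ μ ∈ W, S μ = pointOn (γ μ) (r μ)) (hC : IsC1ImmersionOn S W)
    (hinv : (fderiv ℝ (sweep γ) (μ, 0)).IsInvertible)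
    (h0 : planeDet (fderiv ℝ (fun w => (γ w).1) μ) (fderiv ℝ (fun w => (γ w).2) μ) e₁ e₂ (r μ) = 0)
    {n : E3} (hn : IsNormalAt S μ n) :
    inner ℝ e₁ n + r μ * (inner ℝ e₁ (nablaE0 γ μ 0 e₁) * inner ℝ e₁ n +
      inner ℝ e₂ (nablaE0 γ μ 0 e₁) * inner ℝ e₂ n) = 0 ∧
    inner ℝ e₂ n + r μ * (inner ℝ e₁ (nablaE0 γ μ 0 e₂) * inner ℝ e₁ n +
      inner ℝ e₂ (nablaE0 γ μ 0 e₂) * inner ℝ e₂ n) = 0 := by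
  have hu := hn.inner_direction hγ hμ he hS hC h0
  have hdet := (fderiv_sweep_isInvertible_iff hγ hμ he 0).1 hinv
  have hw : ∀ w : ℂ, inner ℝ e₁ n * (inner ℝ e₁ (fderiv ℝ (fun w => (γ w).2) μ w) +
        r μ * inner ℝ e₁ (fderiv ℝ (fun w => (γ w).1) μ w)) +
      inner ℝ e₂ n * (inner ℝ e₂ (fderiv ℝ (fun w => (γ w).2) μ w) +
        r μ * inner ℝ e₂ (fderiv ℝ (fun w => (γ w).1) μ w)) = 0 := fun w => by
    obtain ⟨c, hc⟩ := fderiv_pointOn_apply hγ hμ hS hC w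
    obtain ⟨-, -, -, hu1, hu2, -⟩ := orthonormal_inner he
    rw [real_inner_comm] at hu1 hu2
    have h := hn.2 w
    rw [hc, orthonormal_inner_eq he, hu] at h
    simpa only [inner_add_right, real_inner_smul_right, hu1, hu2, mul_zero, zero_mul, zero_add,
      add_zero] using h
  have hw1 := hw 1
  have hwI := hw Complex.I
  simp only [inner_fderiv_direction hγ hμ he hinv] at hw1 hwI
  simp only [planeDet, zero_smul, add_zero] at hdet
  constructor
  -- The equations for `w = 1, I` say that `dVᵀ` kills `(1 + r Nᵀ) n`; Cramer's rule removes `dVᵀ`.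
  · apply mul_left_cancel₀ hdet
    linear_combination inner ℝ e₂ (fderiv ℝ (fun w => (γ w).2) μ Complex.I) * hw1 -
      inner ℝ e₂ (fderiv ℝ (fun w => (γ w).2) μ 1) * hwI
  · apply mul_left_cancel₀ hdet
    linear_combination inner ℝ e₁ (fderiv ℝ (fun w => (γ w).2) μ 1) * hwI -
      inner ℝ e₁ (fderiv ℝ (fun w => (γ w).2) μ Complex.I) * hw1

theorem planeDet_eq_mul (hγ : IsLineCongruence γ W) (hμ : μ ∈ W)
    (he : Orthonormal ℝ ![(γ μ).1, e₁, e₂])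
    (hinv : (fderiv ℝ (sweep γ) (μ, 0)).IsInvertible) (r : ℝ) :
    planeDet (fderiv ℝ (fun w => (γ w).1) μ) (fderiv ℝ (fun w => (γ w).2) μ) e₁ e₂ r =
      planeDet (fderiv ℝ (fun w => (γ w).1) μ) (fderiv ℝ (fun w => (γ w).2) μ) e₁ e₂ 0 *
      (1 + r * (inner ℝ e₁ (nablaE0 γ μ 0 e₁) + inner ℝ e₂ (nablaE0 γ μ 0 e₂)) +
        r ^ 2 * (inner ℝ e₁ (nablaE0 γ μ 0 e₁) * inner ℝ e₂ (nablaE0 γ μ 0 e₂) -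
          inner ℝ e₁ (nablaE0 γ μ 0 e₂) * inner ℝ e₂ (nablaE0 γ μ 0 e₁))) := by
  simp only [planeDet, inner_add_right, real_inner_smul_right,
    inner_fderiv_direction hγ hμ he hinv]
  ring

end FocalNormals

end LineGeometry

/-! ### The distance and angle formulas. -/

theorem theorem5 (γ : ℂ → E3 × E3) (W : Set ℂ) (hγ : IsLineCongruence γ W)
    (e₁ e₂ : ℂ → ℝ → E3) (he : IsCongruenceFrame γ W e₁ e₂)
    -- there are exactly two focal points on each line
    (r₁ r₂ : ℂ → ℝ) (hne : ∀ μ ∈ W, r₁ μ ≠ r₂ μ)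
    (hfocal : ∀ μ ∈ W, ∀ r : ℝ, IsFocalAt γ e₁ e₂ μ r ↔ r = r₁ μ ∨ r = r₂ μ)
    -- the optical scalars are finite at `r = 0`
    (hzero : ∀ μ ∈ W, ¬ IsFocalAt γ e₁ e₂ μ 0)
    -- the focal points form two continuously differentiable surfaces
    (S₁ S₂ : ℂ → E3)
    (hS₁ : ∀ μ ∈ W, S₁ μ = pointOn (γ μ) (r₁ μ))
    (hS₂ : ∀ μ ∈ W, S₂ μ = pointOn (γ μ) (r₂ μ))
    (hC₁ : IsC1ImmersionOn S₁ W) (hC₂ : IsC1ImmersionOn S₂ W)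
    (μ : ℂ) (hμ : μ ∈ W) (ρ₀ σ₀ : ℂ)
    (hρ₀ : ρ₀ = opticalRho γ e₁ e₂ μ 0) (hσ₀ : σ₀ = opticalSigma γ e₁ e₂ μ 0) :
    0 < ‖σ₀‖ ^ 2 - ρ₀.im ^ 2 ∧
    ‖ρ₀‖ ^ 2 - ‖σ₀‖ ^ 2 ≠ 0 ∧
    dist (S₁ μ) (S₂ μ) =
      2 * Real.sqrt (‖σ₀‖ ^ 2 - ρ₀.im ^ 2) / |‖ρ₀‖ ^ 2 - ‖σ₀‖ ^ 2| ∧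
    ∀ n₁ n₂ : E3, IsNormalAt S₁ μ n₁ → IsNormalAt S₂ μ n₂ →
      Real.cos (InnerProductGeometry.angle n₁ n₂) ^ 2 = ρ₀.im ^ 2 / ‖σ₀‖ ^ 2 := by
  have hon := (he μ hμ 0).1
  set a := fderiv ℝ (fun w => (γ w).1) μ with ha
  set b := fderiv ℝ (fun w => (γ w).2) μ with hb
  have hf₁ := (hfocal μ hμ (r₁ μ)).2 (Or.inl rfl)
  have hf₂ := (hfocal μ hμ (r₂ μ)).2 (Or.inr rfl)
  have hroot : ∀ r, IsFocalAt γ e₁ e₂ μ r → planeDet a b (e₁ μ 0) (e₂ μ 0) r = 0 := by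
    intro r hr
    by_contra hne'
    exact not_isFocalAt_of_isInvertible hγ hμ he
      ((fderiv_sweep_isInvertible_iff hγ hμ hon r).2 hne') hr
  have hp₁ := hroot _ hf₁
  have hp₂ := hroot _ hf₂
  have h10 : r₁ μ ≠ 0 := fun h => hzero μ hμ (h ▸ hf₁)
  have h20 : r₂ μ ≠ 0 := fun h => hzero μ hμ (h ▸ hf₂)
  -- Being non-focal does not by itself give invertibility; the count of roots does.
  have hinv : (fderiv ℝ (sweep γ) (μ, 0)).IsInvertible := by
    obtain ⟨s, hs⟩ := hf₁.exists_isInvertible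
    rw [fderiv_sweep_isInvertible_iff hγ hμ hon] at hs ⊢
    rw [← ha, ← hb] at hs ⊢
    simp only [planeDet, inner_add_right, real_inner_smul_right] at hp₁ hp₂ hs ⊢
    refine quadratic_const_ne_zero
      (p₁ := inner ℝ (e₁ μ 0) (b 1) * inner ℝ (e₂ μ 0) (a Complex.I) +
        inner ℝ (e₁ μ 0) (a 1) * inner ℝ (e₂ μ 0) (b Complex.I) -
        inner ℝ (e₁ μ 0) (b Complex.I) * inner ℝ (e₂ μ 0) (a 1) -
        inner ℝ (e₁ μ 0) (a Complex.I) * inner ℝ (e₂ μ 0) (b 1))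
      (p₂ := inner ℝ (e₁ μ 0) (a 1) * inner ℝ (e₂ μ 0) (a Complex.I) -
        inner ℝ (e₁ μ 0) (a Complex.I) * inner ℝ (e₂ μ 0) (a 1))
      (s := s) (hne μ hμ) h10 h20 ?_ ?_ ?_
    · linear_combination hp₁
    · linear_combination hp₂
    · intro h
      apply hs
      linear_combination h
  have hdet := (fderiv_sweep_isInvertible_iff hγ hμ hon 0).1 hinv
  have hq₁ := hp₁
  have hq₂ := hp₂
  rw [ha, hb, planeDet_eq_mul hγ hμ hon hinv, mul_eq_zero, or_iff_right hdet] at hq₁ hq₂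
  have hN₁ : ∀ n, IsNormalAt S₁ μ n → _ := fun n hn =>
    And.intro (hn.inner_direction hγ hμ hon hS₁ hC₁ hp₁) (hn.eigenvector hγ hμ hon hS₁ hC₁ hinv hp₁)
  have hN₂ : ∀ n, IsNormalAt S₂ μ n → _ := fun n hn =>
    And.intro (hn.inner_direction hγ hμ hon hS₂ hC₂ hp₂) (hn.eigenvector hγ hμ hon hS₂ hC₂ hinv hp₂)
  have hρ := hρ₀.trans (opticalRho_eq γ e₁ e₂ μ 0)
  have hσ := hσ₀.trans (opticalSigma_eq γ e₁ e₂ μ 0)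
  generalize inner ℝ (e₁ μ 0) (nablaE0 γ μ 0 (e₁ μ 0)) = A at *
  generalize inner ℝ (e₁ μ 0) (nablaE0 γ μ 0 (e₂ μ 0)) = B at *
  generalize inner ℝ (e₂ μ 0) (nablaE0 γ μ 0 (e₁ μ 0)) = C at *
  generalize inner ℝ (e₂ μ 0) (nablaE0 γ μ 0 (e₂ μ 0)) = D at *
  obtain ⟨hd1, ht⟩ := det_mul_roots (hne μ hμ) hq₁ hq₂
  have hρn : ‖ρ₀‖ ^ 2 = ((A + D) / 2) ^ 2 + ((B - C) / 2) ^ 2 := by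
    rw [hρ, norm_sq_neg_add_mul_I]
  have hσn : ‖σ₀‖ ^ 2 = ((A - D) / 2) ^ 2 + ((-B - C) / 2) ^ 2 := by
    rw [hσ, norm_sq_neg_add_mul_I]
  have him : ρ₀.im ^ 2 = ((B - C) / 2) ^ 2 := by
    have : ρ₀.im = -((B - C) / 2) := by
      rw [hρ, Complex.neg_im, Complex.add_im, Complex.ofReal_im, Complex.im_ofReal_mul,
        Complex.I_im, zero_add, mul_one]
    rw [this, neg_sq]
  have hdiff : ‖ρ₀‖ ^ 2 - ‖σ₀‖ ^ 2 = A * D - B * C := by rw [hρn, hσn]; ring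
  have hdisc : ‖σ₀‖ ^ 2 - ρ₀.im ^ 2 = ((A * D - B * C) * (r₁ μ - r₂ μ) / 2) ^ 2 := by
    rw [hσn, him]
    -- The left side is `((A + D)² - 4 (AD - BC)) / 4`; Vieta turns it into a square.
    linear_combination (A + D - (A * D - B * C) * (r₁ μ + r₂ μ)) / 4 * ht +
      (A * D - B * C) * hd1
  have hd0 : A * D - B * C ≠ 0 := left_ne_zero_of_mul_eq_one hd1
  have hr0 := sub_ne_zero.2 (hne μ hμ)
  have hpos : 0 < ‖σ₀‖ ^ 2 - ρ₀.im ^ 2 := by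
    rw [hdisc]; positivity
  refine ⟨hpos, hdiff ▸ hd0, ?_, fun n₁ n₂ hn₁ hn₂ => ?_⟩
  · have hS : S₁ μ - S₂ μ = (r₁ μ - r₂ μ) • (γ μ).1 := by
      rw [hS₁ μ hμ, hS₂ μ hμ, pointOn, pointOn, sub_smul, add_sub_add_left_eq_sub]
    rw [dist_eq_norm, hS, norm_smul, (hγ.mapsTo hμ).1, mul_one, Real.norm_eq_abs, hdiff, hdisc,
      Real.sqrt_sq_eq_abs, abs_div, abs_mul, abs_two]
    field_simp
  · obtain ⟨hu₁, hx₁, hx₂⟩ := hN₁ n₁ hn₁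
    obtain ⟨hu₂, hy₁, hy₂⟩ := hN₂ n₂ hn₂
    have hkey := eigenvectors_dot_sq hd1 hx₁ hx₂ hy₁ hy₂
    have i12 := orthonormal_inner_eq hon n₁ n₂
    have i11 := orthonormal_inner_eq hon n₁ n₁
    have i22 := orthonormal_inner_eq hon n₂ n₂
    rw [hu₁] at i11 i12
    rw [hu₂] at i22
    rw [real_inner_self_eq_norm_sq] at i11 i22
    have hσ0 : ‖σ₀‖ ^ 2 ≠ 0 := (hpos.trans_le (sub_le_self _ (sq_nonneg _))).ne'
    have hn₁0 := norm_ne_zero_iff.2 hn₁.1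
    have hn₂0 := norm_ne_zero_iff.2 hn₂.1
    rw [InnerProductGeometry.cos_angle, div_pow, div_eq_div_iff (by positivity) hσ0, mul_pow, i11,
      i22, i12, him, show ‖σ₀‖ ^ 2 = ((A * D - B * C) * (r₁ μ - r₂ μ) / 2) ^ 2 +
        ((B - C) / 2) ^ 2 by rw [← hdisc, ← him]; ring]
    linear_combination hkey / 4
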